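/- Let $(\mathcal C,\otimes,I)$ be a symmetric monoidal category with associativity isomorphisms $\alpha_{X,Y,Z}:X\otimes(Y\otimes Z)\to(X\otimes Y)\otimes Z$ and symmetry $\sigma$, equipped with a trace $\mathrm{Tr}^U_{X,Y}:\mathcal C(X\otimes U,Y\otimes U)\to\mathcal C(X,Y)$ (natural in $X,Y$, dinatural in $U$, satisfying the two vanishing axioms, yanking and superposing). Let $\mathbf{Int}\,\mathcal C$ be the category obtained from it by the Int construction of Joyal, Street and Verity: objects are pairs $(X,U)$ of objects of $\mathcal C$; $\mathbf{Int}\,\mathcal C((X,U),(Y,V))=\mathcal C(X\otimes V,Y\otimes U)$; the composite of $f:(X,U)\to(Y,V)$ and $g:(Y,V)\to(Z,W)$ is the trace over $V$ of $$(X\otimes W)\otimes V\cong(X\otimes V)\otimes W\xrightarrow{f\otimes 1}(Y\otimes U)\otimes W\cong(Y\otimes W)\otimes U\xrightarrow{g\otimes 1}(Z\otimes V)\otimes U\cong(Z\otimes U)\otimes V ;$$ the tensor is $(X_1,U_1)\,\Box\,(X_2,U_2)=(X_1\otimes X_2,\,U_2\otimes U_1)$, and for $f:(X_1,U_1)\to(Y_1,V_1)$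 and $g:(X_2,U_2)\to(Y_2,V_2)$ the morphism $f\,\Box\,g$ is $f\otimes g$ preceded and followed by the symmetries $(X_1\otimes X_2)\otimes(V_2\otimes V_1)\cong(X_1\otimes V_1)\otimes(X_2\otimes V_2)$ and $(Y_1\otimes U_1)\otimes(Y_2\otimes U_2)\cong(Y_1\otimes Y_2)\otimes(U_2\otimes U_1)$; the unit object is $(I,I)$ and the associativity and unit isomorphisms are the pairs of those of $\mathcal C$; the dual is $(X,U)^*=(U,X)$; the unit of the duality is $\eta_{(X,U)}=\sigma_{I,X\otimes U}:(I,I)\to(X,U)\,\Box\,(X,U)^*$ and the counit is $\epsilon_{(X,U)}=\sigma_{U\otimes X,I}:(X,U)^*\,\Box\,(X,U)\to(I,I)$. For an object $X$ of $\mathbf{Int}\,\mathcal C$, the canonical Frobenius algebra at $X^*\Box X$ has as split and merge arrows the composites $$X^*\Box X\cong X^*\Box(I\,\Box\,X)\xrightarrow{1\Box(\eta_X\Box 1)}X^*\Box((X\Box X^*)\Box X)\cong(X^*\Box X)\Box(X^*\Box X),$$ $$(X^*\Box X)\Box(X^*\Box X)\cong X^*\Box((X\Box X^*)\Box X)\xrightarrow{1\Box(\epsilon_{X^*}\Box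 1)}X^*\Box(I\,\Box\,X)\cong X^*\Box X,$$ where $I$ stands for $(I,I)$. For an object $N$ of $\mathcal C$, the standard Frobenius algebra at the self-dual object $(N,N)$ is obtained from the one for $X=(I,N)$ by transport along the canonical isomorphism $(N,N)\cong(N,I)\,\Box\,(I,N)=X^*\Box X$ given by the unit isomorphism $N\cong N\otimes I$. Then, for every object $N$ of $\mathcal C$, the split and merge arrows of the standard Frobenius algebra at $(N,N)$, $$\Delta\in\mathbf{Int}\,\mathcal C((N,N),(N,N)\Box(N,N))=\mathcal C(N\otimes(N\otimes N),(N\otimes N)\otimes N),$$ $$\nabla\in\mathbf{Int}\,\mathcal C((N,N)\Box(N,N),(N,N))=\mathcal C((N\otimes N)\otimes N,N\otimes(N\otimes N)),$$ are given by the symmetry and associativity isomorphisms of $\mathcal C$: $$\Delta=\alpha_{N,N,N}\,(1_N\otimes\sigma_{N,N}),\qquad\nabla=(1_N\otimes\sigma_{N,N})\,\alpha^{-1}_{N,N,N}$$ (composition in $\mathcal C$, written right to left). -/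

import Mathlib

open CategoryTheory MonoidalCategory

universe v u

/-- A trace on a symmetric monoidal category: a family of maps
`tr U : (X ⊗ U ⟶ Y ⊗ U) → (X ⟶ Y)`, natural in `X` and `Y`, dinatural in `U`, and subject to the
two vanishing axioms, yanking and superposing (with the associativity and unit isomorphisms
written out). -/
class TracedSymmetricCategory (C : Type u) [Category.{v} C] [MonoidalCategory C]
    [SymmetricCategory C] where
  tr {X Y : C} (U : C) (f : X ⊗ U ⟶ Y ⊗ U) : X ⟶ Y
  naturality_left {X X' Y : C} (U : C) (a : X' ⟶ X) (f : X ⊗ U ⟶ Y ⊗ U) :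
    tr U (a ▷ U ≫ f) = a ≫ tr U f
  naturality_right {X Y Y' : C} (U : C) (f : X ⊗ U ⟶ Y ⊗ U) (b : Y ⟶ Y') :
    tr U (f ≫ b ▷ U) = tr U f ≫ b
  dinaturality {X Y U V : C} (f : X ⊗ U ⟶ Y ⊗ V) (c : V ⟶ U) :
    tr U (f ≫ Y ◁ c) = tr V (X ◁ c ≫ f)
  vanishing_unit {X Y : C} (f : X ⊗ 𝟙_ C ⟶ Y ⊗ 𝟙_ C) :
    tr (𝟙_ C) f = (ρ_ X).inv ≫ f ≫ (ρ_ Y).hom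
  vanishing_tensor {X Y : C} (U V : C) (f : X ⊗ (U ⊗ V) ⟶ Y ⊗ (U ⊗ V)) :
    tr (U ⊗ V) f = tr U (tr V ((α_ X U V).hom ≫ f ≫ (α_ Y U V).inv))
  yanking (U : C) : tr U (β_ U U).hom = 𝟙 U
  superposing {X Y A B : C} (U : C) (f : X ⊗ U ⟶ Y ⊗ U) (g : A ⟶ B) :
    tr U (((α_ X A U).hom ≫ X ◁ (β_ A U).hom ≫ (α_ X U A).inv) ≫ (f ⊗ₘ g) ≫
      ((α_ Y U B).hom ≫ Y ◁ (β_ U B).hom ≫ (α_ Y B U).inv)) = tr U f ⊗ₘ g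

namespace TracedSymmetricCategory
variable {C : Type u} [Category.{v} C] [MonoidalCategory C] [SymmetricCategory C]

/-- The canonical isomorphism that interchanges the last two of three factors. -/
def swapLast (X V W : C) : (X ⊗ V) ⊗ W ⟶ (X ⊗ W) ⊗ V :=
  (α_ X V W).hom ≫ X ◁ (β_ V W).hom ≫ (α_ X W V).inv

lemma swapLast_swapLast (X V W : C) : swapLast X V W ≫ swapLast X W V = 𝟙 _ := by
  have h : X ◁ (β_ V W).hom ≫ X ◁ (β_ W V).hom = 𝟙 _ := by
    rw [← MonoidalCategory.whiskerLeft_comp, SymmetricCategory.symmetry,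
      MonoidalCategory.whiskerLeft_id]
  simp [swapLast, reassoc_of% h]

lemma swapLast_naturality {X Y : C} (f : X ⟶ Y) (V W : C) :
    f ▷ V ▷ W ≫ swapLast Y V W = swapLast X V W ≫ f ▷ W ▷ V := by
  simp only [swapLast, Category.assoc]
  rw [associator_naturality_left_assoc, ← whisker_exchange_assoc,
    associator_inv_naturality_left]

lemma swapLast_mid {V V' : C} (X : C) (f : V ⟶ V') (W : C) :
    (X ◁ f) ▷ W ≫ swapLast X V' W = swapLast X V W ≫ (X ⊗ W) ◁ f := by
  simp only [swapLast, Category.assoc]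
  rw [associator_naturality_middle_assoc, ← MonoidalCategory.whiskerLeft_comp_assoc,
    BraidedCategory.braiding_naturality_left, MonoidalCategory.whiskerLeft_comp_assoc,
    associator_inv_naturality_right]

lemma swapLast_last {W W' : C} (X V : C) (f : W ⟶ W') :
    (X ⊗ V) ◁ f ≫ swapLast X V W' = swapLast X V W ≫ (X ◁ f) ▷ V := by
  simp only [swapLast, Category.assoc]
  rw [associator_naturality_right_assoc, ← MonoidalCategory.whiskerLeft_comp_assoc,
    BraidedCategory.braiding_naturality_right, MonoidalCategory.whiskerLeft_comp_assoc,
    associator_inv_naturality_middle]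

lemma swapLast_braid (X A B D : C) :
    swapLast X A B ▷ D ≫ swapLast (X ⊗ B) A D ≫ swapLast X B D ▷ A =
      swapLast (X ⊗ A) B D ≫ swapLast X A D ▷ B ≫ swapLast (X ⊗ D) A B := by
  have h := congrArg (fun t => (𝟙 (((X ⊗ A) ⊗ B) ⊗ D) ⊗≫ X ◁ t ⊗≫ 𝟙 (((X ⊗ D) ⊗ B) ⊗ A))) (BraidedCategory.yang_baxter' A B D)
  convert h using 1 <;> (dsimp only [swapLast]; monoidal)

lemma swapLast_braid_zero (Z U V : C) :
    (β_ Z U).hom ▷ V ≫ swapLast U Z V ≫ (β_ U V).hom ▷ Z =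
      swapLast Z U V ≫ (β_ Z V).hom ▷ U ≫ swapLast V Z U := by
  have h := congrArg (fun t => (𝟙 ((Z ⊗ U) ⊗ V) ⊗≫ t ⊗≫ 𝟙 ((V ⊗ U) ⊗ Z))) (BraidedCategory.yang_baxter' Z U V)
  convert h using 1 <;> (dsimp only [swapLast]; monoidal)

variable [TracedSymmetricCategory C]

lemma superposing_right {X Y : C} (U A : C) (f : X ⊗ U ⟶ Y ⊗ U) :
    tr U f ▷ A = tr U (swapLast X A U ≫ f ▷ A ≫ swapLast Y U A) := by
  have h := superposing U f (𝟙 A)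
  rw [tensorHom_id, tensorHom_id] at h
  exact h.symm

lemma yanking_left (Z U : C) : tr U (swapLast Z U U) = 𝟙 (Z ⊗ U) := by
  have h : swapLast Z U U = (β_ Z U).hom ▷ U ≫ (swapLast U Z U ≫ (β_ U U).hom ▷ Z ≫
      swapLast U U Z) ≫ (β_ U Z).hom ▷ U := by
    have h1 := swapLast_braid_zero U U Z
    have h2 := congrArg (fun t => (β_ Z U).hom ▷ U ≫ swapLast U Z U ≫ t) h1
    beta_reduce at h2
    simp only [Category.assoc]
    rw [h2, ← Category.assoc (swapLast U Z U) (swapLast U U Z), swapLast_swapLast,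
      Category.id_comp, ← comp_whiskerRight_assoc, SymmetricCategory.symmetry, id_whiskerRight,
      Category.id_comp]
  rw [h, naturality_left, naturality_right, ← superposing_right, yanking]
  simp

lemma tr_comm {X Y : C} (U V : C) (f : (X ⊗ U) ⊗ V ⟶ (Y ⊗ U) ⊗ V) :
    tr U (tr V f) = tr V (tr U (swapLast X V U ≫ f ≫ swapLast Y U V)) := by
  have h1 := vanishing_tensor U V ((α_ X U V).inv ≫ f ≫ (α_ Y U V).hom)
  have h2 := vanishing_tensor V U
    (X ◁ (β_ V U).hom ≫ ((α_ X U V).inv ≫ f ≫ (α_ Y U V).hom) ≫ Y ◁ (β_ U V).hom)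
  have h3 := dinaturality (X ◁ (β_ V U).hom ≫ ((α_ X U V).inv ≫ f ≫ (α_ Y U V).hom))
    (β_ U V).hom
  simp only [Category.assoc] at h1 h2 h3
  rw [h3, ← MonoidalCategory.whiskerLeft_comp_assoc, SymmetricCategory.symmetry,
    MonoidalCategory.whiskerLeft_id, Category.id_comp, h1] at h2
  simpa [swapLast] using h2

end TracedSymmetricCategory

open TracedSymmetricCategory

/-- The objects `(X, U)` of `Int C` are the pairs of objects of `C`. -/
structure IntCat (C : Type u) where
  pos : C
  neg : C

namespace IntCat
variable {C : Type u} [Category.{v} C] [MonoidalCategory C] [SymmetricCategory C]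

/-- A morphism `(X, U) ⟶ (Y, V)` of `Int C` is a morphism `X ⊗ V ⟶ Y ⊗ U` of `C`. -/
@[ext]
structure Hom (A B : IntCat C) where
  hom : A.pos ⊗ B.neg ⟶ B.pos ⊗ A.neg

variable [TracedSymmetricCategory C]

/-- The composite of `f : (X, U) ⟶ (Y, V)` and `g : (Y, V) ⟶ (Z, W)` is the trace over `V` of
`(X ⊗ W) ⊗ V ⟶ (X ⊗ V) ⊗ W ⟶ (Y ⊗ U) ⊗ W ⟶ (Y ⊗ W) ⊗ U ⟶ (Z ⊗ V) ⊗ U ⟶ (Z ⊗ U) ⊗ V`,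
with `f` in the second step and `g` in the fourth one. -/
instance : CategoryStruct (IntCat C) where
  Hom A B := Hom A B
  id A := ⟨𝟙 (A.pos ⊗ A.neg)⟩
  comp {A B D} f g := ⟨tr B.neg (swapLast A.pos D.neg B.neg ≫ f.hom ▷ D.neg ≫
    swapLast B.pos A.neg D.neg ≫ g.hom ▷ A.neg ≫ swapLast D.pos B.neg A.neg)⟩

lemma comp_hom {A B D : IntCat C} (f : A ⟶ B) (g : B ⟶ D) :
    (f ≫ g).hom = tr B.neg (swapLast A.pos D.neg B.neg ≫ f.hom ▷ D.neg ≫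
    swapLast B.pos A.neg D.neg ≫ g.hom ▷ A.neg ≫ swapLast D.pos B.neg A.neg) := rfl

lemma id_hom (A : IntCat C) : (𝟙 A : A ⟶ A).hom = 𝟙 (A.pos ⊗ A.neg) := rfl

@[ext]
lemma hom_ext {A B : IntCat C} {f g : A ⟶ B} (h : f.hom = g.hom) : f = g := Hom.ext h

/-- The morphism `a ⊗ b` of `Int C` given by a pair of morphisms of `C`. -/
def ofPair {A B : IntCat C} (a : A.pos ⟶ B.pos) (b : B.neg ⟶ A.neg) : A ⟶ B := ⟨a ⊗ₘ b⟩

lemma id_eq_ofPair (A : IntCat C) : 𝟙 A = ofPair (𝟙 _) (𝟙 _) := by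
  ext; simp [ofPair, id_hom]

lemma ofPair_comp_hom {A B D : IntCat C} (a : A.pos ⟶ B.pos) (b : B.neg ⟶ A.neg) (g : B ⟶ D) :
    (ofPair a b ≫ g).hom = a ▷ D.neg ≫ g.hom ≫ D.pos ◁ b := by
  have e : (ofPair a b ≫ g).hom = tr B.neg ((A.pos ⊗ D.neg) ◁ b ≫ swapLast A.pos D.neg A.neg ≫
      a ▷ A.neg ▷ D.neg ≫ swapLast B.pos A.neg D.neg ≫ g.hom ▷ A.neg ≫
      swapLast D.pos B.neg A.neg) := by
    rw [comp_hom]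
    congr 1
    simp only [ofPair, tensorHom_def', comp_whiskerRight, Category.assoc]
    rw [← Category.assoc, ← swapLast_last]
    simp only [Category.assoc]
  have e2 := swapLast_naturality a A.neg D.neg
  rw [e, ← dinaturality]
  simp only [Category.assoc]
  rw [← swapLast_mid]
  have : swapLast A.pos D.neg A.neg ≫ a ▷ A.neg ▷ D.neg ≫ swapLast B.pos A.neg D.neg ≫
      g.hom ▷ A.neg ≫ (D.pos ◁ b) ▷ A.neg ≫ swapLast D.pos A.neg A.neg =
      (a ▷ D.neg ≫ g.hom ≫ D.pos ◁ b) ▷ A.neg ≫ swapLast D.pos A.neg A.neg := by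
    rw [← Category.assoc (a ▷ A.neg ▷ D.neg), e2]
    simp only [Category.assoc, comp_whiskerRight]
    rw [← Category.assoc, swapLast_swapLast, Category.id_comp]
  rw [this, naturality_left, yanking_left, Category.comp_id]

lemma comp_ofPair_hom {A B D : IntCat C} (f : A ⟶ B) (a : B.pos ⟶ D.pos) (b : D.neg ⟶ B.neg) :
    (f ≫ ofPair a b).hom = A.pos ◁ b ≫ f.hom ≫ a ▷ A.neg := by
  have e : (f ≫ ofPair a b).hom = tr B.neg ((swapLast A.pos D.neg B.neg ≫ f.hom ▷ D.neg ≫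
      a ▷ A.neg ▷ D.neg ≫ swapLast D.pos A.neg D.neg ≫ swapLast D.pos D.neg A.neg) ≫
      (D.pos ⊗ A.neg) ◁ b) := by
    rw [comp_hom]
    congr 1
    simp only [ofPair, MonoidalCategory.tensorHom_def, comp_whiskerRight, Category.assoc]
    rw [swapLast_mid, ← Category.assoc (swapLast B.pos A.neg D.neg), ← swapLast_naturality]
    simp only [Category.assoc]
  rw [e, dinaturality, swapLast_swapLast, Category.comp_id, ← Category.assoc, swapLast_last]
  have : (swapLast A.pos D.neg D.neg ≫ (A.pos ◁ b) ▷ D.neg) ≫ f.hom ▷ D.neg ≫ a ▷ A.neg ▷ D.neg =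
     swapLast A.pos D.neg D.neg ≫ (A.pos ◁ b ≫ f.hom ≫ a ▷ A.neg) ▷ D.neg := by
    simp
  rw [this, naturality_right, yanking_left, Category.id_comp]

lemma comp_assoc {A B D E : IntCat C} (f : A ⟶ B) (g : B ⟶ D) (h : D ⟶ E) :
    (f ≫ g) ≫ h = f ≫ g ≫ h := by
  ext
  obtain ⟨f⟩ := f
  obtain ⟨g⟩ := g
  obtain ⟨h⟩ := h
  obtain ⟨X, U⟩ := A
  obtain ⟨Y, V⟩ := B
  obtain ⟨Z, W⟩ := D
  obtain ⟨T, S⟩ := E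
  dsimp only at f g h
  simp only [comp_hom]
  have hL : tr W (swapLast X S W ≫ (tr V (swapLast X W V ≫ f ▷ W ≫ swapLast Y U W ≫ g ▷ U ≫
        swapLast Z V U)) ▷ S ≫ swapLast Z U S ≫ h ▷ U ≫ swapLast T W U) =
      tr W (tr V (swapLast X S W ▷ V ≫ swapLast (X ⊗ W) S V ≫ swapLast X W V ▷ S ≫
        f ▷ W ▷ S ≫ swapLast Y U W ▷ S ≫ g ▷ U ▷ S ≫ swapLast Z V U ▷ S ≫
        swapLast (Z ⊗ U) V S ≫ swapLast Z U S ▷ V ≫ h ▷ U ▷ V ≫ swapLast T W U ▷ V)) := by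
    rw [superposing_right, ← naturality_right, ← naturality_left]
    simp only [comp_whiskerRight, Category.assoc]
  have hR : tr V (swapLast X S V ≫ f ▷ S ≫ swapLast Y U S ≫ (tr W (swapLast Y S W ≫ g ▷ S ≫
        swapLast Z V S ≫ h ▷ V ≫ swapLast T W V)) ▷ U ≫ swapLast T V U) =
      tr V (tr W (swapLast X S V ▷ W ≫ f ▷ S ▷ W ≫ swapLast Y U S ▷ W ≫
        swapLast (Y ⊗ S) U W ≫ swapLast Y S W ▷ U ≫ g ▷ S ▷ U ≫ swapLast Z V S ▷ U ≫
        h ▷ V ▷ U ≫ swapLast T W V ▷ U ≫ swapLast (T ⊗ V) W U ≫ swapLast T V U ▷ W)) := by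
    rw [superposing_right, ← naturality_right, ← naturality_left, ← naturality_left,
      ← naturality_left]
    simp only [comp_whiskerRight, Category.assoc]
  refine hL.trans (Eq.trans ?_ hR.symm)
  rw [tr_comm V W]
  congr 2
  have b1 := swapLast_braid Y U S W
  have b2 := swapLast_braid T W V U
  have n1 := swapLast_naturality f S W
  have n2 := swapLast_naturality g U S
  have n3 := swapLast_naturality h V U
  have b3 := swapLast_braid X S W V
  have b4 := swapLast_braid Z V U S
  have i1 := swapLast_swapLast (T ⊗ U) W V
  simp only [Category.assoc]
  rw [reassoc_of% b3, reassoc_of% b1, reassoc_of% n1, reassoc_of% b2, i1, Category.comp_id,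
    ← reassoc_of% n2, reassoc_of% b4, reassoc_of% n3]

/-- The category `Int C`. -/
instance : Category (IntCat C) where
  id_comp f := by
    rw [id_eq_ofPair]; ext; simp [ofPair_comp_hom]
  comp_id f := by
    rw [id_eq_ofPair]; ext; simp [comp_ofPair_hom]
  assoc := comp_assoc

/-- Pairs of isomorphisms of `C`, the second one in the reverse direction, are isomorphisms
of `Int C`. -/
def isoOfPair {A B : IntCat C} (a : A.pos ≅ B.pos) (b : B.neg ≅ A.neg) : A ≅ B where
  hom := ofPair a.hom b.hom
  inv := ofPair a.inv b.inv
  hom_inv_id := by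
    ext
    rw [ofPair_comp_hom, id_hom]
    simp only [ofPair, MonoidalCategory.tensorHom_def]
    simp
  inv_hom_id := by
    ext
    rw [ofPair_comp_hom, id_hom]
    simp only [ofPair, MonoidalCategory.tensorHom_def]
    simp

/-- The object `(X₁, U₁) □ (X₂, U₂) = (X₁ ⊗ X₂, U₂ ⊗ U₁)`. -/
abbrev boxObj (A B : IntCat C) : IntCat C := ⟨A.pos ⊗ B.pos, B.neg ⊗ A.neg⟩

/-- The tensor of two morphisms of `Int C`:
`(X₁ ⊗ X₂) ⊗ (V₂ ⊗ V₁) ⟶ (X₁ ⊗ V₁) ⊗ (X₂ ⊗ V₂) ⟶ (Y₁ ⊗ U₁) ⊗ (Y₂ ⊗ U₂)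
  ⟶ (Y₁ ⊗ Y₂) ⊗ (U₂ ⊗ U₁)`,
with `f ⊗ g` in the middle. -/
def boxHom {A₁ B₁ A₂ B₂ : IntCat C} (f : A₁ ⟶ B₁) (g : A₂ ⟶ B₂) :
    boxObj A₁ A₂ ⟶ boxObj B₁ B₂ :=
  ⟨(A₁.pos ⊗ A₂.pos) ◁ (β_ B₂.neg B₁.neg).hom ≫ tensorμ A₁.pos A₂.pos B₁.neg B₂.neg ≫
    (f.hom ⊗ₘ g.hom) ≫
    tensorμ B₁.pos A₁.neg B₂.pos A₂.neg ≫ (B₁.pos ⊗ B₂.pos) ◁ (β_ A₁.neg A₂.neg).hom⟩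

/-- The tensor `□` of `Int C`, its unit object `(I, I)`, and its associativity and unit
isomorphisms, which are the pairs of those of `C`. -/
instance : MonoidalCategoryStruct (IntCat C) where
  tensorObj := boxObj
  whiskerLeft A _ _ f := boxHom (𝟙 A) f
  whiskerRight f A := boxHom f (𝟙 A)
  tensorHom f g := boxHom f g
  tensorUnit := ⟨𝟙_ C, 𝟙_ C⟩
  associator A B D := isoOfPair (α_ A.pos B.pos D.pos) (α_ D.neg B.neg A.neg)
  leftUnitor A := isoOfPair (λ_ A.pos) (ρ_ A.neg).symm
  rightUnitor A := isoOfPair (ρ_ A.pos) (λ_ A.neg).symm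

/-- The dual object, `(X, U)* = (U, X)`. -/
abbrev dual (A : IntCat C) : IntCat C := ⟨A.neg, A.pos⟩

/-- The unit `η_A : I ⟶ A □ A*`, given for `A = (X, U)` by the symmetry of `I` and `X ⊗ U`. -/
def unit (A : IntCat C) : 𝟙_ (IntCat C) ⟶ A ⊗ dual A := ⟨(β_ (𝟙_ C) (A.pos ⊗ A.neg)).hom⟩

/-- The counit `ε_A : A* □ A ⟶ I`, given for `A = (X, U)` by the symmetry of `U ⊗ X` and `I`. -/
def counit (A : IntCat C) : dual A ⊗ A ⟶ 𝟙_ (IntCat C) := ⟨(β_ (A.neg ⊗ A.pos) (𝟙_ C)).hom⟩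

end IntCat

section Frobenius
variable {D : Type u} [Category.{v} D] [MonoidalCategoryStruct D]

/-- The split arrow of the canonical Frobenius algebra at `X* ⊗ X`, where `X' = X*` and
`η : I ⟶ X ⊗ X*` is the unit of the duality:
`X* ⊗ X ≅ X* ⊗ (I ⊗ X) ⟶ X* ⊗ ((X ⊗ X*) ⊗ X) ≅ (X* ⊗ X) ⊗ (X* ⊗ X)`. -/
def canonicalSplit {X X' : D} (η : 𝟙_ D ⟶ X ⊗ X') : X' ⊗ X ⟶ (X' ⊗ X) ⊗ (X' ⊗ X) :=
  X' ◁ (λ_ X).inv ≫ X' ◁ (η ▷ X) ≫ X' ◁ (α_ X X' X).hom ≫ (α_ X' X (X' ⊗ X)).inv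

/-- The merge arrow of the canonical Frobenius algebra at `X* ⊗ X`, where `X' = X*` and
`ε : X ⊗ X* ⟶ I` is the counit of the duality (that of the object `X*`, as `X** = X`):
`(X* ⊗ X) ⊗ (X* ⊗ X) ≅ X* ⊗ ((X ⊗ X*) ⊗ X) ⟶ X* ⊗ (I ⊗ X) ≅ X* ⊗ X`. -/
def canonicalMerge {X X' : D} (ε : X ⊗ X' ⟶ 𝟙_ D) : (X' ⊗ X) ⊗ (X' ⊗ X) ⟶ X' ⊗ X :=
  (α_ X' X (X' ⊗ X)).hom ≫ X' ◁ (α_ X X' X).inv ≫ X' ◁ (ε ▷ X) ≫ X' ◁ (λ_ X).hom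

/-- The split arrow at `S` that corresponds to `Δ` under an isomorphism `S ≅ F`. -/
def transportSplit {S F : D} (e : S ≅ F) (Δ : F ⟶ F ⊗ F) : S ⟶ S ⊗ S :=
  e.hom ≫ Δ ≫ (e.inv ⊗ₘ e.inv)

/-- The merge arrow at `S` that corresponds to `m` under an isomorphism `S ≅ F`. -/
def transportMerge {S F : D} (e : S ≅ F) (m : F ⊗ F ⟶ F) : S ⊗ S ⟶ S :=
  (e.hom ⊗ₘ e.hom) ≫ m ≫ e.inv

end Frobenius

namespace IntCat
variable {C : Type u} [Category.{v} C] [MonoidalCategory C] [SymmetricCategory C]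
  [TracedSymmetricCategory C]

/-- The canonical isomorphism `(N, N) ≅ (N, I) □ (I, N) = X* □ X` for `X = (I, N)`, given by the
unit isomorphisms `N ≅ N ⊗ I` of `C`. -/
def diagIso (N : C) :
    (⟨N, N⟩ : IntCat C) ≅ dual ⟨𝟙_ C, N⟩ ⊗ (⟨𝟙_ C, N⟩ : IntCat C) :=
  isoOfPair (ρ_ N).symm (ρ_ N)

/-- The split arrow of the standard Frobenius algebra at `(N, N) ≅ (N, I) □ (I, N)`. -/
def standardSplit (N : C) : (⟨N, N⟩ : IntCat C) ⟶ ⟨N, N⟩ ⊗ ⟨N, N⟩ :=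
  transportSplit (diagIso N) (canonicalSplit (unit ⟨𝟙_ C, N⟩))

/-- The merge arrow of the standard Frobenius algebra at `(N, N) ≅ (N, I) □ (I, N)`. -/
def standardMerge (N : C) : (⟨N, N⟩ ⊗ ⟨N, N⟩ : IntCat C) ⟶ ⟨N, N⟩ :=
  transportMerge (diagIso N) (canonicalMerge (counit (dual ⟨𝟙_ C, N⟩)))

end IntCat

namespace IntCat
variable {C : Type u} [Category.{v} C] [MonoidalCategory C] [SymmetricCategory C]

/-! Every factor of the split and merge arrows except the unit or counit of the duality is a pair of
morphisms of `C` (`ofPair`). Pairs are closed under composition (`ofPair_comp_ofPair`) and under `□`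
(`boxHom_ofPair`), and composing any morphism with a pair on either side involves no trace
(`ofPair_comp_hom`, `comp_ofPair_hom`). The traces therefore disappear, and each arrow becomes a
composite of structural isomorphisms of `C` around the box of the unit or counit with identities.

For `X = (I, N)` almost every symmetry in that box has a unit object as an argument and is trivial.
The exception is the symmetry by which `□` reverses the order of the negative components: it
interchanges `N` and `I ⊗ N`, so it contributes one `β_ N N`. The rest is coherence for monoidal
categories. -/

/-- The interchange of the two middle factors is an involution because the braiding is symmetric. -/
lemma tensorμ_tensorμ (X Y Z W : C) : tensorμ X Y Z W ≫ tensorμ X Z Y W = 𝟙 _ := by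
  simp only [tensorμ, Category.assoc, Iso.inv_hom_id_assoc]
  simp only [← MonoidalCategory.whiskerLeft_comp_assoc, ← comp_whiskerRight_assoc,
    Iso.hom_inv_id_assoc, SymmetricCategory.symmetry]
  simp

variable [TracedSymmetricCategory C]

@[simp] lemma tensorObj_pos (A B : IntCat C) : (A ⊗ B).pos = A.pos ⊗ B.pos := rfl
@[simp] lemma tensorObj_neg (A B : IntCat C) : (A ⊗ B).neg = B.neg ⊗ A.neg := rfl
@[simp] lemma tensorUnit_pos : (𝟙_ (IntCat C)).pos = 𝟙_ C := rfl
@[simp] lemma tensorUnit_neg : (𝟙_ (IntCat C)).neg = 𝟙_ C := rfl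

lemma ofPair_comp_ofPair {A B D : IntCat C} (a : A.pos ⟶ B.pos) (b : B.neg ⟶ A.neg)
    (a' : B.pos ⟶ D.pos) (b' : D.neg ⟶ B.neg) :
    ofPair a b ≫ ofPair a' b' = ofPair (a ≫ a') (b' ≫ b) := by
  ext
  rw [ofPair_comp_hom]
  simp [ofPair, MonoidalCategory.tensorHom_def]

/-- By naturality the second interchange moves past the pairs and cancels the first. The two outer
symmetries then cancel in the same way, which turns `b₁ ⊗ₘ b₂` into `b₂ ⊗ₘ b₁`. -/
lemma boxHom_ofPair {A₁ B₁ A₂ B₂ : IntCat C} (a₁ : A₁.pos ⟶ B₁.pos) (b₁ : B₁.neg ⟶ A₁.neg)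
    (a₂ : A₂.pos ⟶ B₂.pos) (b₂ : B₂.neg ⟶ A₂.neg) :
    boxHom (ofPair a₁ b₁) (ofPair a₂ b₂) =
      ofPair (A := boxObj A₁ A₂) (B := boxObj B₁ B₂) (a₁ ⊗ₘ a₂) (b₂ ⊗ₘ b₁) := by
  ext
  dsimp only [boxHom, ofPair]
  rw [tensorμ_natural_assoc, reassoc_of% tensorμ_tensorμ,
    ← id_tensorHom, ← id_tensorHom, tensorHom_comp_tensorHom, tensorHom_comp_tensorHom]
  simp

lemma standardSplit_hom (N : C) :
    (standardSplit N).hom = N ◁ (β_ N N).hom ≫ (α_ N N N).inv := by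
  -- Writing identities as pairs makes `boxHom_ofPair` apply to every whiskering except those of the
  -- unit.
  simp only [standardSplit, transportSplit, canonicalSplit, diagIso, isoOfPair, whiskerLeft,
    whiskerRight, MonoidalCategoryStruct.tensorHom, MonoidalCategoryStruct.associator,
    MonoidalCategoryStruct.leftUnitor, id_eq_ofPair, Category.assoc, boxHom_ofPair,
    ofPair_comp_ofPair]
  -- With composites bracketed to the right, the pairs after the unit have merged into one, while
  -- two separate pairs still precede it.
  rw [ofPair_comp_hom, ofPair_comp_hom, comp_ofPair_hom]
  dsimp only [boxHom, ofPair, unit, Iso.symm_hom, Iso.symm_inv, tensorObj_pos, tensorObj_neg,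
    tensorUnit_pos, tensorUnit_neg]
  -- The hexagon reduces `β_ N (I ⊗ N)` to `β_ N N`, the only braiding left on either side, so
  -- `monoidal` can treat it as an atom.
  simp only [BraidedCategory.braiding_tensor_right_hom, braiding_tensorUnit_left,
    braiding_tensorUnit_right, tensorμ]
  monoidal

lemma standardMerge_hom (N : C) :
    (standardMerge N).hom = (α_ N N N).hom ≫ N ◁ (β_ N N).hom := by
  simp only [standardMerge, transportMerge, canonicalMerge, diagIso, isoOfPair, whiskerLeft,
    whiskerRight, MonoidalCategoryStruct.tensorHom, MonoidalCategoryStruct.associator,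
    MonoidalCategoryStruct.leftUnitor, id_eq_ofPair, Category.assoc, boxHom_ofPair,
    ofPair_comp_ofPair]
  rw [ofPair_comp_hom, ofPair_comp_hom, ofPair_comp_hom, comp_ofPair_hom]
  dsimp only [boxHom, ofPair, counit, Iso.symm_hom, Iso.symm_inv, tensorObj_pos, tensorObj_neg,
    tensorUnit_pos, tensorUnit_neg]
  -- Here the surviving symmetry is `β_ (I ⊗ N) N`, which comes after the counit rather than before
  -- it, so the other hexagon is needed.
  simp only [BraidedCategory.braiding_tensor_left_hom, BraidedCategory.braiding_tensor_right_hom,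
    braiding_tensorUnit_left, braiding_tensorUnit_right, tensorμ]
  monoidal

end IntCat

/-- Mathlib's associator goes from `(X ⊗ Y) ⊗ Z` to `X ⊗ (Y ⊗ Z)`, so it is the inverse of the `α`
of the informal statement, and `≫` reverses the written order of composition. -/
theorem mainTheorem12 {C : Type u} [Category.{v} C] [MonoidalCategory C] [SymmetricCategory C]
    [TracedSymmetricCategory C] (N : C) :
    (IntCat.standardSplit N).hom = N ◁ (β_ N N).hom ≫ (α_ N N N).inv ∧
      (IntCat.standardMerge N).hom = (α_ N N N).hom ≫ N ◁ (β_ N N).hom :=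
  ⟨IntCat.standardSplit_hom N, IntCat.standardMerge_hom N⟩
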